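/- Let $(R,\mathfrak m)$ be a commutative local ring which is chained (any two ideals are comparable under inclusion), which has a nonzero zero divisor, and whose set of zero divisors $Z(R)=\{r\in R : rs=0 \text{ for some } s\neq 0\}$ equals $\mathfrak m$. For an $R$-module $M$, the weak dimension of $M$ is the least length $n\ge 0$ of a flat resolution $0\to E_n\to\cdots\to E_0\to M\to 0$ ($\infty$ if there is none), and $\operatorname{w.gl.dim}(R)$ is the supremum of the weak dimensions of all $R$-modules. Then $$\operatorname{w.gl.dim}(R)=\infty .$$ Moreover, writing $(0:x)=\{r\in R: xr=0\}$: (a) If $0\neq x\in\mathfrak m$ and $(0:x)=yR$ is cyclic, then $$\cdots\xrightarrow{\,y\,}R\xrightarrow{\,x\,}R\xrightarrow{\,y\,}R\xrightarrow{\,x\,}xR\to 0$$ is exact (a 2-periodic free resolution of $xR$), and neither $xR$ nor any of the syzygies (kernels of the maps in this resolution) is flat. (b) If $(0:x)$ is not cyclic for any $0\neq x\in\mathfrak m$, then there are a non-flat $R$-module $M$ and a free resolution $\cdots\to F_1\to F_0\to M\to 0$ none of whose syzygies (the kernels of $F_0\to M$ and of $F_{n+1}\to F_n$, $n\ge 0$)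 is flat. -/

import Mathlib

universe u v w

/-- A chained ring: any two ideals are comparable under inclusion. -/
def IsChainedRing (R : Type u) [CommRing R] : Prop :=
  ∀ I J : Ideal R, I ≤ J ∨ J ≤ I

/-- The set of zero divisors of `R`; it contains `0` when `R` is nontrivial. -/
def zeroDivisorSet (R : Type u) [CommRing R] : Set R :=
  {r | ∃ s : R, s ≠ 0 ∧ r * s = 0}

/-- The annihilator `(0 : x)` of an element of `R`. -/
def annIdeal {R : Type u} [CommRing R] (x : R) : Ideal R :=
  LinearMap.ker (LinearMap.mulLeft R x)

/-- Exactness of `⋯ → F 2 → F 1 → F 0 → M → 0`, with maps `d n : F (n + 1) → F n` and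
`ε : F 0 → M`. -/
structure IsLeftResolution {R : Type u} [CommRing R] {M : Type v} [AddCommGroup M] [Module R M]
    {F : ℕ → Type w} [∀ n, AddCommGroup (F n)] [∀ n, Module R (F n)]
    (d : ∀ n, F (n + 1) →ₗ[R] F n) (ε : F 0 →ₗ[R] M) : Prop where
  surjective : Function.Surjective ε
  exact_zero : Function.Exact (d 0) ε
  exact_succ : ∀ n, Function.Exact (d (n + 1)) (d n)

/-- The syzygies of a resolution: `ker ε`, `ker (d 0)`, `ker (d 1)`, and so on.
The predicate says that none of them is flat. -/
def NoFlatSyzygy {R : Type u} [CommRing R] {M : Type v} [AddCommGroup M] [Module R M]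
    {F : ℕ → Type w} [∀ n, AddCommGroup (F n)] [∀ n, Module R (F n)]
    (d : ∀ n, F (n + 1) →ₗ[R] F n) (ε : F 0 →ₗ[R] M) : Prop :=
  ¬ Module.Flat R (LinearMap.ker ε) ∧ ∀ n, ¬ Module.Flat R (LinearMap.ker (d n))

/-- `M` has a flat resolution `0 → E n → ⋯ → E 1 → E 0 → M → 0`
(the terms of index larger than `n` are zero). -/
def HasWeakDimLE (R : Type u) [CommRing R] (M : Type u) [AddCommGroup M] [Module R M]
    (n : ℕ) : Prop :=
  ∃ (E : ℕ → ModuleCat.{u} R) (d : ∀ k, E (k + 1) →ₗ[R] E k) (ε : E 0 →ₗ[R] M),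
    (∀ k, Module.Flat R (E k)) ∧ (∀ k, n < k → Subsingleton (E k)) ∧ IsLeftResolution (F := fun k => E k) d ε

/-- The weak (flat) dimension of `M`: the least length of a flat resolution,
and `⊤` if there is no finite one. -/
noncomputable def weakDim (R : Type u) [CommRing R] (M : Type u) [AddCommGroup M] [Module R M] :
    ℕ∞ :=
  sInf {m : ℕ∞ | ∃ n : ℕ, m = n ∧ HasWeakDimLE R M n}

/-- The weak global dimension of `R`: the supremum of the weak dimensions of all `R`-modules. -/
noncomputable def weakGlobalDim (R : Type u) [CommRing R] : ℕ∞ :=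
  ⨆ M : ModuleCat.{u} R, weakDim R M

/-! In a chained ring divisibility is total, so `M` is flat exactly when every relation `a • m = 0`
comes from some `m = b • m'` with `a * b = 0` (`flat_iff_forall_smul_eq_zero`). A Schanuel argument
(`FlatDimLE.syzygy`) shows that a module of finite weak dimension is flat or has a flat syzygy in
every projective resolution. It therefore suffices to find a non-flat module with a free resolution
without flat syzygies.

Since `Z(R) = m`, one has `(0 : (0 : x)) = xR` (`dvd_of_annIdeal_le`), and `xR` is not flat for `0 ≠
x ∈ m`. If `(0 : x) = yR`, then `(0 : y) = xR`, so all syzygies of `xR` are `xR` or `yR`. If no such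
annihilator is cyclic, the module is a non-flat `(0 : x)`, the kernel of `x` on `R`. It and its
syzygies are kernels of maps between flat modules, and for such modules a flat next syzygy forces
flatness (`flat_of_second_syzygy`); hence non-flatness passes from each syzygy to the next. -/

open Function IsLocalRing
open scoped TensorProduct

/-! ### Flatness over rings with total divisibility -/

section PrincipalRelations

variable {R : Type u} [CommRing R] [PreValuationRing R]

/-- One of the coefficients divides all the others and can be factored out; being one of them, it is
still killed by `a`. -/
theorem exists_sum_smul_eq_smul {M : Type v} [AddCommGroup M] [Module R M]
    {ι : Type*} (s : Finset ι) (a : R) (b : ι → R) (m : ι → M) (h : ∀ j ∈ s, a * b j = 0) :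
    ∃ (c : R) (m' : M), a * c = 0 ∧ ∑ j ∈ s, b j • m j = c • m' := by
  classical
  induction s using Finset.induction_on with
  | empty => exact ⟨0, 0, by simp⟩
  | insert j s hj ih =>
    obtain ⟨c, m', hc, hs⟩ := ih fun k hk => h k (Finset.mem_insert_of_mem hk)
    have hb := h j (Finset.mem_insert_self j s)
    rw [Finset.sum_insert hj, hs]
    obtain ⟨t, ht⟩ | ⟨t, ht⟩ := ValuationRing.dvd_total c (b j)
    · exact ⟨c, m' + t • m j, hc, by rw [smul_add, smul_smul, ← ht, add_comm]⟩
    · exact ⟨b j, m j + t • m', hb, by rw [smul_add, smul_smul, ← ht]⟩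

/-- Over a ring whose elements are totally ordered by divisibility, flatness is tested by
relations of length one. -/
theorem flat_iff_forall_smul_eq_zero {M : Type v} [AddCommGroup M] [Module R M] :
    Module.Flat R M ↔
      ∀ (a : R) (m : M), a • m = 0 → ∃ (b : R) (m' : M), a * b = 0 ∧ m = b • m' := by
  constructor
  · intro _ a m h
    obtain ⟨ι, b, y, hy, hb⟩ := Module.Flat.isTrivialRelation_of_sum_smul_eq_zero
      (R := R) (ι := Unit) (f := fun _ => a) (x := fun _ => m) (by simpa using h)
    obtain ⟨c, m', hc, hs⟩ := exists_sum_smul_eq_smul Finset.univ a (b ()) y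
      (fun j _ => by simpa using hb j)
    exact ⟨c, m', hc, (hy ()).trans hs⟩
  · intro h
    -- Finitely generated ideals are principal, so injectivity need only be tested on `aR`, where
    -- every tensor has the form `m ⊗ a`.
    have : IsBezout R := IsBezout.iff_span_pair_isPrincipal.2 fun x y => by
      obtain hxy | hyx := ValuationRing.dvd_total x y
      · exact ⟨x, by rw [Ideal.span_pair_comm, Ideal.span_pair_eq_span_right_iff_dvd.2 hxy]⟩
      · exact ⟨y, by rw [Ideal.span_pair_eq_span_right_iff_dvd.2 hyx]⟩
    rw [Module.Flat.iff_lTensor_injective]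
    intro I hI
    obtain ⟨a, rfl⟩ := (IsBezout.isPrincipal_of_FG I hI).principal
    rw [← LinearMap.ker_eq_bot, LinearMap.ker_eq_bot']
    have haI : a ∈ R ∙ a := Submodule.mem_span_singleton_self a
    have hpure (t : M ⊗[R] (R ∙ a)) : ∃ m : M, t = m ⊗ₜ[R] (⟨a, haI⟩ : R ∙ a) := by
      induction t with
      | zero => exact ⟨0, by simp⟩
      | tmul m z =>
        obtain ⟨z, hz⟩ := z
        obtain ⟨r, rfl⟩ := Submodule.mem_span_singleton.1 hz
        exact ⟨r • m, (TensorProduct.smul_tmul r m (⟨a, haI⟩ : R ∙ a)).symm⟩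
      | add t₁ t₂ h₁ h₂ =>
        obtain ⟨m₁, rfl⟩ := h₁
        obtain ⟨m₂, rfl⟩ := h₂
        exact ⟨m₁ + m₂, (TensorProduct.add_tmul _ _ _).symm⟩
    intro t ht
    obtain ⟨m, rfl⟩ := hpure t
    obtain ⟨b, m', hab, rfl⟩ := h a m (by
      simpa using congrArg (TensorProduct.rid R M) ht)
    have hb : b • (⟨a, haI⟩ : R ∙ a) = 0 := Subtype.ext (by simpa [mul_comm] using hab)
    rw [TensorProduct.smul_tmul, hb, TensorProduct.tmul_zero]

theorem flat_prod {M : Type v} {N : Type w} [AddCommGroup M] [Module R M] [AddCommGroup N]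
    [Module R N] (hM : Module.Flat R M) (hN : Module.Flat R N) : Module.Flat R (M × N) := by
  rw [flat_iff_forall_smul_eq_zero] at hM hN ⊢
  rintro a ⟨m, n⟩ h
  obtain ⟨b, m', hb, rfl⟩ := hM a m (congrArg Prod.fst h)
  obtain ⟨c, n', hc, rfl⟩ := hN a n (congrArg Prod.snd h)
  obtain ⟨t, rfl⟩ | ⟨t, rfl⟩ := ValuationRing.dvd_total b c
  · exact ⟨b, (m', t • n'), hb, by simp [smul_smul]⟩
  · exact ⟨c, (t • m', n'), hc, by simp [smul_smul]⟩

theorem flat_ker_of_surjective {X : Type v} {F : Type w} [AddCommGroup X] [Module R X]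
    [AddCommGroup F] [Module R F] [Module.Flat R X] [Module.Flat R F] (f : X →ₗ[R] F)
    (hf : Surjective f) : Module.Flat R (LinearMap.ker f) := by
  rw [flat_iff_forall_smul_eq_zero]
  rintro a ⟨k, hk⟩ h
  rw [LinearMap.mem_ker] at hk
  obtain ⟨b, x, hab, rfl⟩ := flat_iff_forall_smul_eq_zero.1 ‹Module.Flat R X› a k
    (congrArg Subtype.val h)
  -- Flatness of `F` corrects `x` by `c • y`, which moves it into the kernel without changing `b •
  -- x`, because `b * c = 0`.
  obtain ⟨c, z, hbc, hz⟩ := flat_iff_forall_smul_eq_zero.1 ‹Module.Flat R F› b (f x)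
    (by rw [← map_smul, hk])
  obtain ⟨y, rfl⟩ := hf z
  refine ⟨b, ⟨x - c • y, by simp [hz]⟩, hab, Subtype.ext ?_⟩
  simp [smul_sub, smul_smul, hbc]

end PrincipalRelations

/-! ### Flat dimension and syzygies -/

section FlatDimension

/-- `M` has flat dimension at most `n`, by recursion on `n`. -/
def FlatDimLE (R : Type u) [CommRing R] :
    ℕ → ∀ (M : Type u) [AddCommGroup M] [Module R M], Prop
  | 0, M, _, _ => Module.Flat R M
  | n + 1, M, _, _ => ∃ (K H : Type u) (_ : AddCommGroup K) (_ : Module R K)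
      (_ : AddCommGroup H) (_ : Module R H) (i : K →ₗ[R] H) (f : H →ₗ[R] M),
      Injective i ∧ Exact i f ∧ Surjective f ∧ Module.Flat R H ∧ FlatDimLE R n K

variable {R : Type u} [CommRing R]

theorem FlatDimLE.of_linearEquiv {n : ℕ} {M N : Type u} [AddCommGroup M] [Module R M]
    [AddCommGroup N] [Module R N] (e : M ≃ₗ[R] N) (h : FlatDimLE R n M) : FlatDimLE R n N := by
  cases n with
  | zero =>
    have : Module.Flat R M := h
    exact Module.Flat.of_linearEquiv e.symm
  | succ n =>
    obtain ⟨K, H, _, _, _, _, i, f, hi, hex, hf, hH, hK⟩ := h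
    refine ⟨K, H, _, _, _, _, i, e.toLinearMap ∘ₗ f, hi, fun y => ?_,
      e.surjective.comp hf, hH, hK⟩
    simpa using hex y

theorem FlatDimLE.prod_flat [PreValuationRing R] {n : ℕ} {K : Type u} (P : Type u) [AddCommGroup K] [Module R K]
    [AddCommGroup P] [Module R P] [Module.Flat R P] (h : FlatDimLE R n K) :
    FlatDimLE R n (K × P) := by
  cases n with
  | zero =>
    have : Module.Flat R K := h
    exact flat_prod this inferInstance
  | succ n =>
    obtain ⟨L, H, _, _, _, _, i, f, hi, hex, hf, hH, hK⟩ := h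
    refine ⟨L, H × P, _, _, inferInstance, inferInstance, LinearMap.inl R H P ∘ₗ i,
      f.prodMap LinearMap.id, LinearMap.inl_injective.comp hi, ?_,
      Prod.map_surjective.2 ⟨hf, surjective_id⟩, flat_prod hH inferInstance, hK⟩
    rintro ⟨a, p⟩
    have := hex a
    simp only [Set.mem_range] at this
    constructor
    · intro h
      simp only [LinearMap.prodMap_apply, LinearMap.id_apply, Prod.mk_eq_zero] at h
      obtain ⟨y, rfl⟩ := this.1 h.1
      exact ⟨y, by simp [h.2]⟩
    · rintro ⟨y, hy⟩
      simp only [LinearMap.comp_apply, LinearMap.inl_apply, Prod.mk.injEq] at hy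
      simp [← hy.2, this.2 ⟨y, hy.1⟩]

/-- Only the flat term `G` over `X` has to change: it is replaced by the kernel of `G → X → F`,
which is flat and still contains `L`. -/
theorem FlatDimLE.ker_of_surjective [PreValuationRing R] {n : ℕ} {X F : Type u}
    [AddCommGroup X] [Module R X] [AddCommGroup F] [Module R F] [Module.Flat R F]
    (φ : X →ₗ[R] F) (hφ : Surjective φ) (h : FlatDimLE R n X) :
    FlatDimLE R n (LinearMap.ker φ) := by
  cases n with
  | zero =>
    have : Module.Flat R X := h
    exact flat_ker_of_surjective φ hφ
  | succ n =>
    obtain ⟨L, G, _, _, _, _, i, g, hi, hex, hg, hG, hL⟩ := h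
    have hmem (l : L) : i l ∈ LinearMap.ker (φ ∘ₗ g) := by
      simp [(hex (i l)).2 ⟨l, rfl⟩]
    have hmem' (y : LinearMap.ker (φ ∘ₗ g)) : g y ∈ LinearMap.ker φ := y.2
    refine ⟨L, LinearMap.ker (φ ∘ₗ g), _, _, inferInstance, inferInstance, i.codRestrict _ hmem,
      (g ∘ₗ Submodule.subtype _).codRestrict _ hmem', ?_, ?_, ?_,
      flat_ker_of_surjective (φ ∘ₗ g) (hφ.comp hg), hL⟩
    · exact fun a b hab => hi (congrArg Subtype.val hab)
    · rintro ⟨y, hy⟩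
      have := hex y
      simp only [Set.mem_range] at this ⊢
      simp only [← Subtype.coe_inj]
      exact this
    · rintro ⟨x, hx⟩
      obtain ⟨y, rfl⟩ := hg x
      exact ⟨⟨y, hx⟩, rfl⟩

/-- Schanuel's argument: lifting `π` to `s : P → H` gives a surjection `K × P → H` whose kernel
projects isomorphically onto `ker π`. -/
theorem FlatDimLE.syzygy [PreValuationRing R] {n : ℕ} {M P : Type u} [AddCommGroup M]
    [Module R M] [AddCommGroup P] [Module R P] [Module.Projective R P] (π : P →ₗ[R] M)
    (hπ : Surjective π) (h : FlatDimLE R (n + 1) M) : FlatDimLE R n (LinearMap.ker π) := by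
  obtain ⟨K, H, _, _, _, _, i, f, hi, hex, hf, hH, hK⟩ := h
  obtain ⟨s, hs⟩ := Module.projective_lifting_property f π hf
  have hs' (p : P) : f (s p) = π p := LinearMap.congr_fun hs p
  have hfi (k : K) : f (i k) = 0 := (hex _).2 ⟨k, rfl⟩
  let φ : K × P →ₗ[R] H := i.coprod s
  have hφ : Surjective φ := by
    intro y
    obtain ⟨p, hp⟩ := hπ (f y)
    obtain ⟨k, hk⟩ := (hex (y - s p)).1 (by rw [map_sub, hs', hp, sub_self])
    exact ⟨(k, p), by simp [φ, hk]⟩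
  have hker := FlatDimLE.ker_of_surjective φ hφ (FlatDimLE.prod_flat P hK)
  have hmem (z : LinearMap.ker φ) : (z : K × P).2 ∈ LinearMap.ker π := by
    have hz : i (z : K × P).1 + s (z : K × P).2 = 0 := z.2
    rw [LinearMap.mem_ker, ← hs', eq_neg_of_add_eq_zero_right hz, map_neg, hfi, neg_zero]
  refine hker.of_linearEquiv (LinearEquiv.ofBijective
    ((LinearMap.snd R K P ∘ₗ Submodule.subtype _).codRestrict _ hmem) ⟨?_, ?_⟩)
  · rw [← LinearMap.ker_eq_bot, LinearMap.ker_eq_bot']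
    rintro ⟨⟨k, p⟩, hz⟩ h
    obtain rfl : p = 0 := congrArg Subtype.val h
    have hk : k = 0 := hi (by simpa [φ] using hz)
    simp [hk]
  · rintro ⟨p, hp⟩
    rw [LinearMap.mem_ker] at hp
    obtain ⟨k, hk⟩ := (hex (-s p)).1 (by rw [map_neg, hs', hp, neg_zero])
    exact ⟨⟨(k, p), by simp [φ, hk]⟩, rfl⟩

/-- Dropping the term of index `0` of a resolution of `M` leaves a resolution of its first
syzygy. -/
theorem IsLeftResolution.shift {M : Type v} [AddCommGroup M] [Module R M]
    {F : ℕ → Type w} [∀ n, AddCommGroup (F n)] [∀ n, Module R (F n)]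
    {d : ∀ n, F (n + 1) →ₗ[R] F n} {ε : F 0 →ₗ[R] M} (h : IsLeftResolution d ε) :
    ∃ ε' : F 1 →ₗ[R] LinearMap.ker ε, LinearMap.ker ε' = LinearMap.ker (d 0) ∧
      IsLeftResolution (F := fun n => F (n + 1)) (fun n => d (n + 1)) ε' := by
  have hmem (y : F 1) : d 0 y ∈ LinearMap.ker ε := (h.exact_zero _).2 ⟨y, rfl⟩
  refine ⟨(d 0).codRestrict _ hmem, LinearMap.ker_codRestrict _ _ _, ?_, ?_,
    fun n => h.exact_succ (n + 1)⟩
  · rintro ⟨y, hy⟩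
    obtain ⟨z, rfl⟩ := (h.exact_zero y).1 hy
    exact ⟨z, rfl⟩
  · intro y
    rw [← h.exact_succ 0 y]
    simp [Subtype.ext_iff]

theorem HasWeakDimLE.flatDimLE {n : ℕ} {M : Type u} [AddCommGroup M] [Module R M]
    (h : HasWeakDimLE R M n) : FlatDimLE R n M := by
  induction n generalizing M with
  | zero =>
    obtain ⟨E, d, ε, hE, hsub, hres⟩ := h
    have := hE 0
    have := hsub 1 one_pos
    refine Module.Flat.of_linearEquiv (LinearEquiv.ofBijective ε ⟨?_, hres.surjective⟩).symm
    rw [← LinearMap.ker_eq_bot, LinearMap.ker_eq_bot']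
    intro y hy
    obtain ⟨z, rfl⟩ := (hres.exact_zero y).1 hy
    rw [Subsingleton.elim z 0, map_zero]
  | succ n ih =>
    obtain ⟨E, d, ε, hE, hsub, hres⟩ := h
    obtain ⟨ε', -, hres'⟩ := hres.shift
    refine ⟨LinearMap.ker ε, E 0, _, _, _, _, Submodule.subtype _, ε, Subtype.val_injective,
      LinearMap.exact_subtype_ker_map ε, hres.surjective, hE 0, ih ?_⟩
    exact ⟨fun k => E (k + 1), fun k => d (k + 1), ε', fun k => hE _,
      fun k hk => hsub _ (by lia), hres'⟩

theorem not_flatDimLE_of_noFlatSyzygy [PreValuationRing R] {n : ℕ} {M : Type u}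
    [AddCommGroup M] [Module R M] {F : ℕ → Type u} [∀ n, AddCommGroup (F n)]
    [∀ n, Module R (F n)] [∀ n, Module.Projective R (F n)] {d : ∀ n, F (n + 1) →ₗ[R] F n}
    {ε : F 0 →ₗ[R] M} (hM : ¬ Module.Flat R M) (hres : IsLeftResolution d ε)
    (hsyz : NoFlatSyzygy d ε) : ¬ FlatDimLE R n M := by
  induction n generalizing M F with
  | zero => exact hM
  | succ n ih =>
    intro h
    obtain ⟨ε', hker, hres'⟩ := hres.shift
    refine ih (F := fun n => F (n + 1)) hsyz.1 hres' ⟨?_, fun n => hsyz.2 (n + 1)⟩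
      (h.syzygy ε hres.surjective)
    rw [hker]
    exact hsyz.2 0

theorem weakGlobalDim_eq_top_of_noFlatSyzygy [PreValuationRing R] {M : Type u}
    [AddCommGroup M] [Module R M] {F : ℕ → Type u} [∀ n, AddCommGroup (F n)]
    [∀ n, Module R (F n)] [∀ n, Module.Projective R (F n)] {d : ∀ n, F (n + 1) →ₗ[R] F n}
    {ε : F 0 →ₗ[R] M} (hM : ¬ Module.Flat R M) (hres : IsLeftResolution d ε)
    (hsyz : NoFlatSyzygy d ε) : weakGlobalDim R = ⊤ := by
  refine top_unique (le_trans ?_ (le_iSup (fun N : ModuleCat.{u} R => weakDim R N)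
    (ModuleCat.of R M)))
  refine le_sInf ?_
  rintro _ ⟨n, -, hn⟩
  exact (not_flatDimLE_of_noFlatSyzygy hM hres hsyz hn.flatDimLE).elim

end FlatDimension

/-! ### Annihilators and the cyclic case -/

section ZeroDivisors

variable {R : Type u} [CommRing R]

theorem mem_annIdeal {x r : R} : r ∈ annIdeal x ↔ x * r = 0 := Iff.rfl

theorem exact_mulLeft_of_annIdeal_eq_span {x y : R} (h : annIdeal x = Ideal.span {y}) :
    Exact (LinearMap.mulLeft R y) (LinearMap.mulLeft R x) := by
  intro r
  change r ∈ annIdeal x ↔ _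
  rw [h, Ideal.mem_span_singleton]
  exact ⟨fun ⟨t, ht⟩ => ⟨t, ht.symm⟩, fun ⟨t, ht⟩ => ⟨t, ht.symm⟩⟩

variable [IsLocalRing R]

theorem exists_mul_eq_zero_of_mem_maximalIdeal
    (hZ : zeroDivisorSet R = (maximalIdeal R : Set R)) {r : R} (hr : r ∈ maximalIdeal R) :
    ∃ s : R, s ≠ 0 ∧ r * s = 0 :=
  hZ.symm.subset hr

theorem mem_maximalIdeal_of_mul_eq_zero {r s : R} (hs : s ≠ 0) (h : r * s = 0) :
    r ∈ maximalIdeal R :=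
  (mem_maximalIdeal r).2 fun hr => hs (hr.mul_right_eq_zero.1 h)

variable [PreValuationRing R]

/-- If `s ≠ 0` kills `x`, flatness would give `x = b * (x * t)` with `s * b = 0`. Then `b ∈ m`, so
`1 - b * t` is a unit and `x = 0`. -/
theorem not_flat_span_singleton (hZ : zeroDivisorSet R = (maximalIdeal R : Set R)) {x : R}
    (hx : x ∈ maximalIdeal R) (hx0 : x ≠ 0) : ¬ Module.Flat R (Ideal.span {x}) := by
  intro h
  obtain ⟨s, hs, hxs⟩ := exists_mul_eq_zero_of_mem_maximalIdeal hZ hx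
  obtain ⟨b, ⟨m, hm⟩, hb, hxm⟩ := flat_iff_forall_smul_eq_zero.1 h s
    ⟨x, Ideal.mem_span_singleton_self x⟩ (Subtype.ext (by simpa [mul_comm] using hxs))
  obtain ⟨t, rfl⟩ := Ideal.mem_span_singleton.1 hm
  have hbm : b ∈ maximalIdeal R := mem_maximalIdeal_of_mul_eq_zero hs (by rw [mul_comm, hb])
  have hunit : IsUnit (1 - b * t) :=
    isUnit_one_sub_self_of_mem_nonunits _ ((maximalIdeal R).mul_mem_right t hbm)
  have hx' : x = b * (x * t) := congrArg Subtype.val hxm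
  exact hx0 (hunit.mul_right_eq_zero.1 (by linear_combination hx'))

/-- Principal ideals are annihilators: `(0 : (0 : x)) = xR`. -/
theorem dvd_of_annIdeal_le (hZ : zeroDivisorSet R = (maximalIdeal R : Set R)) {x z : R}
    (h : annIdeal x ≤ annIdeal z) : x ∣ z := by
  obtain hd | ⟨r, rfl⟩ := ValuationRing.dvd_total x z
  · exact hd
  by_cases hr : r ∈ maximalIdeal R
  · obtain ⟨s, hs, hrs⟩ := exists_mul_eq_zero_of_mem_maximalIdeal hZ hr
    -- Here `x = z * r` and `r * s = 0`. If `s = z * t`, then `t` kills `x`, hence `z`, so `s = 0`.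
    -- If `z = s * t`, then `x = 0`, so `1` kills `z` and `z = 0`.
    obtain ⟨t, rfl⟩ | ⟨t, rfl⟩ := ValuationRing.dvd_total z s
    · refine (hs (h (x := t) ?_)).elim
      rw [mem_annIdeal]
      linear_combination hrs
    · have h1 : s * t * 1 = 0 := h (x := 1) (by
        rw [mem_annIdeal]
        linear_combination t * hrs)
      exact Dvd.intro 0 (by linear_combination -h1)
  · obtain ⟨v, hv⟩ := (notMem_maximalIdeal.1 hr).exists_right_inv
    exact ⟨v, by rw [mul_assoc, hv, mul_one]⟩

theorem annIdeal_eq_span_of_annIdeal_eq_span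
    (hZ : zeroDivisorSet R = (maximalIdeal R : Set R)) {x y : R}
    (h : annIdeal x = Ideal.span {y}) : annIdeal y = Ideal.span {x} := by
  have hxy : x * y = 0 := by
    rw [← mem_annIdeal, h]
    exact Ideal.mem_span_singleton_self y
  ext z
  rw [Ideal.mem_span_singleton, mem_annIdeal]
  constructor
  · refine fun hz => dvd_of_annIdeal_le hZ ?_
    rw [h, Ideal.span_singleton_le_iff_mem, mem_annIdeal, mul_comm, hz]
  · rintro ⟨t, rfl⟩
    linear_combination t * hxy

/-- The two-periodic resolution of `xR` when `(0 : x) = yR`. -/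
theorem exists_periodic_resolution (hZ : zeroDivisorSet R = (maximalIdeal R : Set R))
    {x y : R} (hx : x ∈ maximalIdeal R) (hx0 : x ≠ 0) (h : annIdeal x = Ideal.span {y}) :
    ∃ ε : R →ₗ[R] Ideal.span {x},
      (∀ r, (ε r : R) = x * r) ∧
      IsLeftResolution (F := fun _ => R)
        (fun n => LinearMap.mulLeft R (if Even n then y else x)) ε ∧
      ¬ Module.Flat R (Ideal.span {x}) ∧
      NoFlatSyzygy (F := fun _ => R)
        (fun n => LinearMap.mulLeft R (if Even n then y else x)) ε := by
  have h' := annIdeal_eq_span_of_annIdeal_eq_span hZ h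
  have hxy : x * y = 0 := by
    rw [← mem_annIdeal, h]
    exact Ideal.mem_span_singleton_self y
  have hy : y ∈ maximalIdeal R := mem_maximalIdeal_of_mul_eq_zero hx0 (by rw [mul_comm, hxy])
  have hy0 : y ≠ 0 := by
    rintro rfl
    obtain ⟨s, hs, hxs⟩ := exists_mul_eq_zero_of_mem_maximalIdeal hZ hx
    rw [← mem_annIdeal, h] at hxs
    exact hs (by simpa using hxs)
  have hmem (r : R) : LinearMap.mulLeft R x r ∈ Ideal.span {x} :=
    Ideal.mul_mem_right _ _ (Ideal.mem_span_singleton_self x)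
  have hker : LinearMap.ker ((LinearMap.mulLeft R x).codRestrict (Ideal.span {x}) hmem) =
      Ideal.span {y} := (LinearMap.ker_codRestrict _ _ _).trans h
  have hnx := not_flat_span_singleton hZ hx hx0
  have hny := not_flat_span_singleton hZ hy hy0
  refine ⟨(LinearMap.mulLeft R x).codRestrict _ hmem, fun r => rfl, ⟨?_, ?_, ?_⟩, hnx, ?_, ?_⟩
  · rintro ⟨r, hr⟩
    obtain ⟨t, rfl⟩ := Ideal.mem_span_singleton.1 hr
    exact ⟨t, rfl⟩
  · intro r
    rw [← LinearMap.mem_ker, hker, ← h]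
    exact exact_mulLeft_of_annIdeal_eq_span h r
  · intro n
    by_cases hn : Even n
    · simpa [hn, Nat.even_add_one] using exact_mulLeft_of_annIdeal_eq_span h'
    · simpa [hn, Nat.even_add_one] using exact_mulLeft_of_annIdeal_eq_span h
  · rwa [hker]
  · intro n
    by_cases hn : Even n
    · beta_reduce
      rw [if_pos hn]
      change ¬ Module.Flat R (annIdeal y)
      rwa [h']
    · beta_reduce
      rw [if_neg hn]
      change ¬ Module.Flat R (annIdeal x)
      rwa [h]

end ZeroDivisors

/-! ### Noncyclic annihilators -/

section NoncyclicAnnihilators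

variable {R : Type u} [CommRing R] [IsLocalRing R] [PreValuationRing R]

/-- A factorization expressing that the maximal ideal is flat when no annihilator is cyclic. -/
theorem exists_eq_mul_of_annIdeal_ne_span
    (hnc : ∀ x ∈ maximalIdeal R, x ≠ 0 → ∀ y : R, annIdeal x ≠ Ideal.span {y}) {b c : R}
    (hc : c ∈ maximalIdeal R) (hc0 : c ≠ 0) (h : c * b = 0) :
    ∃ b₁ b₂ : R, b₂ ∈ maximalIdeal R ∧ c * b₁ = 0 ∧ b = b₂ * b₁ := by
  have hlt : ¬ annIdeal c ≤ Ideal.span {b} := fun hle => hnc c hc hc0 b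
    (le_antisymm hle ((Ideal.span_singleton_le_iff_mem _).2 h))
  obtain ⟨b₁, hb₁, hb⟩ := Set.not_subset.1 hlt
  rw [SetLike.mem_coe, Ideal.mem_span_singleton] at hb
  obtain ⟨b₂, rfl⟩ := (ValuationRing.dvd_total b b₁).resolve_left hb
  refine ⟨b₁, b₂, (mem_maximalIdeal _).2 fun hu => hb ?_, hb₁, mul_comm _ _⟩
  exact hu.mul_right_dvd.2 dvd_rfl

/-- If no annihilator is cyclic, a second syzygy of flat dimension at most one is flat. -/
theorem flat_of_second_syzygy (hZ : zeroDivisorSet R = (maximalIdeal R : Set R))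
    (hnc : ∀ x ∈ maximalIdeal R, x ≠ 0 → ∀ y : R, annIdeal x ≠ Ideal.span {y})
    {G H L F P : Type*} [AddCommGroup G] [Module R G] [AddCommGroup H] [Module R H]
    [AddCommGroup L] [Module R L] [AddCommGroup F] [Module R F] [AddCommGroup P] [Module R P]
    [Module.Flat R G] [Module.Flat R H] [Module.Flat R F] [Module.Flat R P]
    {g : G →ₗ[R] H} {q : H →ₗ[R] L} {i : L →ₗ[R] F} {p : F →ₗ[R] P}
    (hg : Injective g) (hgq : Exact g q) (hq : Surjective q) (hi : Injective i)
    (hip : Exact i p) : Module.Flat R L := by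
  rw [flat_iff_forall_smul_eq_zero]
  intro z l hzl
  by_cases hz : z ∈ maximalIdeal R
  swap
  · refine ⟨0, 0, mul_zero z, ?_⟩
    rw [(notMem_maximalIdeal.1 hz).smul_eq_zero.1 hzl, smul_zero]
  by_cases hz0 : z = 0
  · exact ⟨1, l, by simp [hz0], (one_smul R l).symm⟩
  -- `l` lies in `mF`, hence in `mL`
  obtain ⟨b, l', hb, rfl⟩ : ∃ (b : R) (l' : L), b ∈ maximalIdeal R ∧ l = b • l' := by
    obtain ⟨b, f, hzb, hf⟩ := flat_iff_forall_smul_eq_zero.1 ‹Module.Flat R F› z (i l)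
      (by rw [← map_smul, hzl, map_zero])
    have hb := mem_maximalIdeal_of_mul_eq_zero hz0 (by rw [mul_comm, hzb])
    have hbf : b • p f = 0 := by rw [← map_smul, ← hf]; exact (hip _).2 ⟨l, rfl⟩
    obtain ⟨c, k, hbc, hk⟩ := flat_iff_forall_smul_eq_zero.1 ‹Module.Flat R P› b (p f) hbf
    by_cases hpf : p f = 0
    · obtain ⟨l', rfl⟩ := (hip f).1 hpf
      exact ⟨b, l', hb, hi (by rw [hf, map_smul])⟩
    have hc0 : c ≠ 0 := fun h => hpf (by rw [hk, h, zero_smul])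
    by_cases hb0 : b = 0
    · exact ⟨0, 0, Ideal.zero_mem _, hi (by rw [hf, hb0, zero_smul, smul_zero, map_zero])⟩
    have hc : c ∈ maximalIdeal R := mem_maximalIdeal_of_mul_eq_zero hb0 (by rw [mul_comm, hbc])
    -- As `(0 : c)` is larger than `bR`, part of `b` can be split off inside `m`, and the remaining
    -- factor `b₁` already moves `f` into `ker p`.
    obtain ⟨b₁, b₂, hb₂, hcb, rfl⟩ :=
      exists_eq_mul_of_annIdeal_ne_span hnc hc hc0 ((mul_comm c b).trans hbc)
    obtain ⟨l', hl'⟩ := (hip (b₁ • f)).1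
      (by rw [map_smul, hk, smul_smul, mul_comm, hcb, zero_smul])
    exact ⟨b₂, l', hb₂, hi (by rw [hf, map_smul, hl', smul_smul])⟩
  by_cases hzb : z * b = 0
  · exact ⟨b, l', hzb, rfl⟩
  -- Since `u` kills `z * b` but not `z`, the coefficient `c` that flatness of `G` produces below,
  -- with `u * c = 0`, must be a multiple of `z`. Then `z` can be cancelled up to a relation in `H`.
  obtain ⟨u, huz, hub⟩ : ∃ u : R, u * z ≠ 0 ∧ u * (z * b) = 0 := by
    obtain ⟨s, hs, hbs⟩ := exists_mul_eq_zero_of_mem_maximalIdeal hZ hb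
    obtain ⟨t, rfl⟩ | ⟨t, rfl⟩ := ValuationRing.dvd_total z s
    · exact ⟨t, by rwa [mul_comm], by linear_combination hbs⟩
    · exact (hzb (by linear_combination t * hbs)).elim
  obtain ⟨y, rfl⟩ := hq l'
  obtain ⟨e, he⟩ := (hgq ((z * b) • y)).1 (by rw [map_smul, mul_smul, hzl])
  obtain ⟨c, e', huc, rfl⟩ := flat_iff_forall_smul_eq_zero.1 ‹Module.Flat R G› u e
    (hg (by rw [map_smul, he, smul_smul, hub, zero_smul, map_zero]))
  obtain ⟨t, rfl⟩ : z ∣ c := by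
    refine (ValuationRing.dvd_total z c).resolve_right ?_
    rintro ⟨t, rfl⟩
    exact huz (by rw [← mul_assoc, huc, zero_mul])
  obtain ⟨a, y', hza, hy'⟩ := flat_iff_forall_smul_eq_zero.1 ‹Module.Flat R H› z
    (b • y - t • g e') (by rw [smul_sub, smul_smul, smul_smul, ← he, map_smul, sub_self])
  refine ⟨a, q y', hza, ?_⟩
  have hqe : q (g e') = 0 := (hgq _).2 ⟨e', rfl⟩
  rw [← map_smul, ← map_smul, ← hy', map_sub, map_smul q t, hqe, smul_zero, sub_zero]

theorem not_flat_annIdeal_of_mul_ne_zero (hZ : zeroDivisorSet R = (maximalIdeal R : Set R))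
    {x u : R} (hx : x ∈ maximalIdeal R) (hu : u ∈ maximalIdeal R) (hxu : x * u ≠ 0) :
    ¬ Module.Flat R (annIdeal x) := by
  intro h
  -- Flatness would give `(0 : x) = u (0 : x)`. If `x ∣ u`, this makes `(0 : x)` zero; if `x = u *
  -- x'`, it gives `(0 : x) = (0 : x')`, so `x ∣ x'` and `x' = 0`.
  have key (s : R) (hs : x * s = 0) : ∃ s' : R, x * s' = 0 ∧ s = u * s' := by
    obtain ⟨b, ⟨m, hm⟩, hb, hsm⟩ := flat_iff_forall_smul_eq_zero.1 h x ⟨s, hs⟩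
      (Subtype.ext hs)
    rw [mem_annIdeal] at hm
    obtain ⟨c, rfl⟩ : u ∣ b := by
      refine (ValuationRing.dvd_total u b).resolve_right ?_
      rintro ⟨t, rfl⟩
      exact hxu (by rw [← mul_assoc, hb, zero_mul])
    have hs' : s = u * c * m := congrArg Subtype.val hsm
    exact ⟨c * m, by linear_combination c * hm, by rw [hs', mul_assoc]⟩
  obtain ⟨v, rfl⟩ | ⟨x', rfl⟩ := ValuationRing.dvd_total x u
  · obtain ⟨s, hs, hxs⟩ := exists_mul_eq_zero_of_mem_maximalIdeal hZ hx
    obtain ⟨s', hs', rfl⟩ := key s hxs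
    exact hs (by linear_combination v * hs')
  · obtain ⟨v, hv⟩ : u * x' ∣ x' := by
      refine dvd_of_annIdeal_le hZ fun s hs => ?_
      obtain ⟨s', hs', rfl⟩ := key s hs
      rw [mem_annIdeal]
      linear_combination hs'
    have hunit : IsUnit (1 - u * v) :=
      isUnit_one_sub_self_of_mem_nonunits _ ((maximalIdeal R).mul_mem_right v hu)
    have hx' : x' = 0 := hunit.mul_right_eq_zero.1 (by linear_combination hv)
    exact hxu (by rw [hx', mul_zero, zero_mul])

/-- If `m² ≠ 0`, the preceding lemma applies. If `m² = 0`, then `(0 : x) = m = xR` for any nonzero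
`x ∈ m`, which is cyclic. -/
theorem exists_not_flat_annIdeal (hZ : zeroDivisorSet R = (maximalIdeal R : Set R))
    (hm : ∃ r ∈ maximalIdeal R, r ≠ 0)
    (hnc : ∀ x ∈ maximalIdeal R, x ≠ 0 → ∀ y : R, annIdeal x ≠ Ideal.span {y}) :
    ∃ x : R, ¬ Module.Flat R (annIdeal x) := by
  obtain ⟨x, hx, hx0⟩ := hm
  by_cases h : ∃ u ∈ maximalIdeal R, ∃ y ∈ maximalIdeal R, y * u ≠ 0
  · obtain ⟨u, hu, y, hy, hyu⟩ := h
    exact ⟨y, not_flat_annIdeal_of_mul_ne_zero hZ hy hu hyu⟩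
  push Not at h
  refine (hnc x hx hx0 x (le_antisymm (fun s hs => ?_) ?_)).elim
  · rw [Ideal.mem_span_singleton]
    have hsm : s ∈ maximalIdeal R := mem_maximalIdeal_of_mul_eq_zero hx0 (by rw [mul_comm]; exact hs)
    refine dvd_of_annIdeal_le hZ fun t ht => ?_
    exact h t (mem_maximalIdeal_of_mul_eq_zero hx0 (by rw [mul_comm]; exact ht)) s hsm
  · rw [Ideal.span_singleton_le_iff_mem]
    exact h x hx x hx

end NoncyclicAnnihilators

/-! ### The standard free resolution and its syzygies -/

section StandardResolution

variable (R : Type u) [CommRing R] (M : ModuleCat.{u} R)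

/-- The iterated syzygies of `M` in its standard free resolution. -/
noncomputable def standardSyzygy : ℕ → ModuleCat.{u} R
  | 0 => M
  | n + 1 => ModuleCat.of R
      (LinearMap.ker (Finsupp.linearCombination R (id : standardSyzygy n → standardSyzygy n)))

/-- The free module on the elements of the `n`-th standard syzygy. -/
noncomputable def standardTerm (n : ℕ) : ModuleCat.{u} R :=
  ModuleCat.of R (standardSyzygy R M n →₀ R)

noncomputable def standardCover (n : ℕ) : standardTerm R M n →ₗ[R] standardSyzygy R M n :=
  Finsupp.linearCombination R id

noncomputable def standardInclusion (n : ℕ) :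
    standardSyzygy R M (n + 1) →ₗ[R] standardTerm R M n :=
  Submodule.subtype
    (LinearMap.ker (Finsupp.linearCombination R
      (id : standardSyzygy R M n → standardSyzygy R M n)))

theorem standardCover_surjective (n : ℕ) : Surjective (standardCover R M n) :=
  Finsupp.linearCombination_id_surjective R _

theorem standardInclusion_injective (n : ℕ) : Injective (standardInclusion R M n) :=
  Submodule.subtype_injective _

theorem exact_standardInclusion_standardCover (n : ℕ) :
    Exact (standardInclusion R M n) (standardCover R M n) :=
  LinearMap.exact_subtype_ker_map _

instance (n : ℕ) : Module.Free R (standardTerm R M n) :=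
  inferInstanceAs (Module.Free R (standardSyzygy R M n →₀ R))

noncomputable def standardDifferential (n : ℕ) :
    standardTerm R M (n + 1) →ₗ[R] standardTerm R M n :=
  standardInclusion R M n ∘ₗ standardCover R M (n + 1)

theorem ker_standardDifferential (n : ℕ) :
    LinearMap.ker (standardDifferential R M n) = LinearMap.ker (standardCover R M (n + 1)) :=
  LinearMap.ker_comp_of_ker_eq_bot _
    (LinearMap.ker_eq_bot.2 (standardInclusion_injective R M n))

theorem range_standardDifferential (n : ℕ) :
    LinearMap.range (standardDifferential R M n) = LinearMap.ker (standardCover R M n) := by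
  rw [standardDifferential, LinearMap.range_comp_of_range_eq_top _
    (LinearMap.range_eq_top.2 (standardCover_surjective R M (n + 1))),
    (exact_standardInclusion_standardCover R M n).linearMap_ker_eq]

theorem isLeftResolution_standard :
    IsLeftResolution (F := fun n => standardTerm R M n) (standardDifferential R M)
      (standardCover R M 0) where
  surjective := standardCover_surjective R M 0
  exact_zero := LinearMap.exact_iff.2 (range_standardDifferential R M 0).symm
  exact_succ n := LinearMap.exact_iff.2
    ((ker_standardDifferential R M n).trans (range_standardDifferential R M (n + 1)).symm)

theorem noFlatSyzygy_standard (h : ∀ n, ¬ Module.Flat R (standardSyzygy R M (n + 1))) :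
    NoFlatSyzygy (F := fun n => standardTerm R M n) (standardDifferential R M)
      (standardCover R M 0) := by
  refine ⟨h 0, fun n => ?_⟩
  rw [ker_standardDifferential]
  exact h (n + 1)

variable {R} [IsLocalRing R] [PreValuationRing R]

theorem not_flat_standardSyzygy (hZ : zeroDivisorSet R = (maximalIdeal R : Set R))
    (hnc : ∀ x ∈ maximalIdeal R, x ≠ 0 → ∀ y : R, annIdeal x ≠ Ideal.span {y}) {x : R}
    (hx : ¬ Module.Flat R (annIdeal x)) (n : ℕ) :
    ¬ Module.Flat R (standardSyzygy R (ModuleCat.of R (annIdeal x)) n) := by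
  generalize hM : ModuleCat.of R (annIdeal x) = M
  have descend {n : ℕ} {F P : Type u} [AddCommGroup F] [Module R F] [AddCommGroup P]
      [Module R P] [Module.Flat R F] [Module.Flat R P] {i : standardSyzygy R M n →ₗ[R] F}
      {p : F →ₗ[R] P} (hi : Injective i) (hip : Exact i p)
      (h : Module.Flat R (standardSyzygy R M (n + 1))) :
      Module.Flat R (standardSyzygy R M n) :=
    flat_of_second_syzygy hZ hnc (standardInclusion_injective R M n)
      (exact_standardInclusion_standardCover R M n) (standardCover_surjective R M n) hi hip
  -- The module in degree `0` is itself a kernel, that of multiplication by `x` on `R`; this starts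
  -- the induction.
  have base : ∃ i : standardSyzygy R M 0 →ₗ[R] R, Injective i ∧
      Exact i (LinearMap.mulLeft R x) := by
    subst hM
    exact ⟨Submodule.subtype (annIdeal x), Subtype.val_injective,
      LinearMap.exact_subtype_ker_map _⟩
  obtain ⟨i, hi, hix⟩ := base
  induction n with
  | zero => subst hM; exact hx
  | succ n ih =>
    refine fun h => ih ?_
    cases n with
    | zero => exact descend hi hix h
    | succ n =>
      cases n with
      | zero =>
        -- In degree `1` there is no differential out of `F 0` yet, so the composite `F 0 → (0 : x)
        -- → R` takes its place.
        refine descend (standardInclusion_injective R M 0) (p := i ∘ₗ standardCover R M 0) ?_ h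
        exact (exact_standardInclusion_standardCover R M 0).comp_injective _ hi (map_zero i)
      | succ n =>
        refine descend (standardInclusion_injective R M (n + 1))
          (p := standardDifferential R M n) ?_ h
        exact (exact_standardInclusion_standardCover R M (n + 1)).comp_injective _
          (standardInclusion_injective R M n) (map_zero _)

end StandardResolution

theorem theoremA4 (R : Type u) [CommRing R] [IsLocalRing R]
    (hchain : IsChainedRing R)
    (hzd : ∃ r ∈ zeroDivisorSet R, r ≠ 0)
    (hZ : zeroDivisorSet R = (IsLocalRing.maximalIdeal R : Set R)) :
    -- the weak global dimension is infinite
    weakGlobalDim R = ⊤ ∧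
    -- cyclic annihilator: multiplication by `y` and by `x` in turn resolves `xR`,
    -- and neither `xR` nor any syzygy is flat
    (∀ x y : R, x ∈ IsLocalRing.maximalIdeal R → x ≠ 0 → annIdeal x = Ideal.span {y} →
      ∃ ε : R →ₗ[R] Ideal.span {x},
        (∀ r, (ε r : R) = x * r) ∧
        IsLeftResolution (F := fun _ => R)
          (fun n => LinearMap.mulLeft R (if Even n then y else x)) ε ∧
        ¬ Module.Flat R (Ideal.span {x}) ∧
        NoFlatSyzygy (F := fun _ => R)
          (fun n => LinearMap.mulLeft R (if Even n then y else x)) ε) ∧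
    -- no cyclic annihilator: some module has a free resolution without flat syzygies
    ((∀ x ∈ IsLocalRing.maximalIdeal R, x ≠ 0 → ∀ y : R, annIdeal x ≠ Ideal.span {y}) →
      ∃ (M : ModuleCat.{u} R) (F : ℕ → ModuleCat.{u} R)
        (d : ∀ n, F (n + 1) →ₗ[R] F n) (ε : F 0 →ₗ[R] M),
        (∀ n, Module.Free R (F n)) ∧ IsLeftResolution (F := fun n => F n) d ε ∧
        ¬ Module.Flat R M ∧ NoFlatSyzygy (F := fun n => F n) d ε) := by
  have : PreValuationRing R := PreValuationRing.iff_ideal_total.2 ⟨hchain⟩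
  have hm : ∃ r ∈ IsLocalRing.maximalIdeal R, r ≠ 0 := by
    obtain ⟨r, hr, hr0⟩ := hzd
    exact ⟨r, hZ.subset hr, hr0⟩
  refine ⟨?_, fun x y hx hx0 h => exists_periodic_resolution hZ hx hx0 h, fun hnc => ?_⟩
  · by_cases hnc : ∀ x ∈ IsLocalRing.maximalIdeal R, x ≠ 0 → ∀ y : R,
        annIdeal x ≠ Ideal.span {y}
    · obtain ⟨x, hx⟩ := exists_not_flat_annIdeal hZ hm hnc
      exact weakGlobalDim_eq_top_of_noFlatSyzygy (not_flat_standardSyzygy hZ hnc hx 0)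
        (isLeftResolution_standard R (ModuleCat.of R (annIdeal x)))
        (noFlatSyzygy_standard R _ fun n => not_flat_standardSyzygy hZ hnc hx (n + 1))
    · push Not at hnc
      obtain ⟨x, hx, hx0, y, h⟩ := hnc
      obtain ⟨ε, -, hres, hM, hsyz⟩ := exists_periodic_resolution hZ hx hx0 h
      exact weakGlobalDim_eq_top_of_noFlatSyzygy hM hres hsyz
  · obtain ⟨x, hx⟩ := exists_not_flat_annIdeal hZ hm hnc
    exact ⟨ModuleCat.of R (annIdeal x), standardTerm R _, standardDifferential R _,
      standardCover R _ 0, inferInstance, isLeftResolution_standard R _,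
      not_flat_standardSyzygy hZ hnc hx 0,
      noFlatSyzygy_standard R _ fun n => not_flat_standardSyzygy hZ hnc hx (n + 1)⟩
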